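/- For an oriented link $L$ let $P_L(a,z)\in\mathbb Z[a^{\pm1},z^{\pm1}]$ be its Jones–Conway (Homfly) polynomial, that is, the isotopy invariant of (non-empty) oriented links with $P_{T_1}(a,z)=1$ for the trivial knot $T_1$ and $$a\,P_{L_+}(a,z)+a^{-1}P_{L_-}(a,z)=z\,P_{L_0}(a,z)$$ whenever $L_+$, $L_-$, $L_0$ have diagrams that are identical except near one crossing, which is positive in $L_+$, negative in $L_-$, and smoothed according to the orientation in $L_0$. For an integer $k\ge 0$, a $\bar t_{2k}$ move on an oriented link $L$ replaces, in some diagram of $L$, two neighbouring parallel arcs of opposite orientations by the same two arcs twisted around each other by $2k$ positive (right-handed) half twists, i.e. half twists which would be positive crossings if the two arcs had the same orientation (so that the $2k$ new crossings are negative); the result, with the orientation inherited from $L$, is denoted $\bar t_{2k}(L)$. **Corollary 1.8.** Let $k\ge 0$ be an integer and let $a_0$ be a non-zero complex number with $a_0^{2k}=(-1)^k$ and $a_0\neq\pm i$. Then a $\bar t_{2k}$ move does not change the polynomial specialized at $a=a_0$: for every oriented link $L$ and every link $\bar t_{2k}(L)$ obtained from $L$ by a $\bar t_{2k}$ move, $$P_{\bar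 t_{2k}(L)}(a_0,z)=P_L(a_0,z)\quad\text{in }\mathbb C[z^{\pm1}].$$ -/

import Mathlib

/-! # Oriented links by sliced diagrams, the Jones-Conway polynomial, and antiparallel twists

A link diagram in the plane, in general position with respect to the height function, is cut by
horizontal lines into slices, each of which contains exactly one local minimum, one local maximum
or one crossing, next to vertical strands.  It is recorded as the list of these events, read from
bottom to top.  A horizontal line meets the diagram in a row of oriented strands, recorded as a
list of booleans: `true` for a strand that points up, `false` for one that points down. -/

namespace LinkDiagram

/-- The event in a slice.
* `cup s` is a local minimum; its left leg has direction `s`, its right leg the opposite one.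
* `cap` is a local maximum.
* `cross o` is a crossing of two adjacent strands; the strand that runs from bottom left to top
  right (in whichever direction it is oriented) is the upper one if and only if `o = true`. -/
inductive Piece where
  | cup (s : Bool)
  | cap
  | cross (o : Bool)

/-- Number of strands that enter an event from below. -/
def Piece.ins : Piece → ℕ
  | .cup _ => 0
  | .cap => 2
  | .cross _ => 2

/-- Number of strands that leave an event upwards. -/
def Piece.outs : Piece → ℕ
  | .cup _ => 2
  | .cap => 0
  | .cross _ => 2

/-- A slice: an event together with the number of vertical strands on its left. -/
abbrev Slice := Piece × ℕ

/-- The row of oriented strands above a slice, given the row below it; `none` if the slice does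
not fit (too few strands, or a maximum that would join two strands of the same direction). -/
def applySlice : Slice → List Bool → Option (List Bool)
  | (.cup s, n), w => if n ≤ w.length then some (w.take n ++ s :: (!s) :: w.drop n) else none
  | (.cap, n), w =>
      match w.drop n with
      | x :: y :: r => if x = !y then some (w.take n ++ r) else none
      | _ => none
  | (.cross _, n), w =>
      match w.drop n with
      | x :: y :: r => some (w.take n ++ y :: x :: r)
      | _ => none

/-- The row of oriented strands above a stack of slices, given the row below it. -/
def run (W : List Slice) (w : List Bool) : Option (List Bool) :=
  W.foldlM (fun v e => applySlice e v) w

end LinkDiagram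

open LinkDiagram

/-- A diagram of a (nonempty) oriented link: a stack of slices that fit together, with no strand
below it and no strand above it. -/
structure LinkDiagram where
  word : List Slice
  nonempty : word ≠ []
  closed : run word [] = some []

namespace LinkDiagram

/-- The local moves that generate isotopy of links in terms of sliced diagrams: the planar
isotopies that change the height function, and the three Reidemeister moves. -/
inductive LocalMove : List Slice → List Slice → Prop
  /-- Two events, `g` to the right of `f`, exchange their heights. -/
  | exchange (f g : Piece) (p d : ℕ) :
      LocalMove [(f, p), (g, p + f.outs + d)] [(g, p + f.ins + d), (f, p)]
  /-- A maximum and a minimum on the same strand cancel. -/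
  | zigzag_left (s : Bool) (n : ℕ) : LocalMove [(.cup s, n + 1), (.cap, n)] []
  | zigzag_right (s : Bool) (n : ℕ) : LocalMove [(.cup s, n), (.cap, n + 1)] []
  /-- A strand slides across a minimum, or across a maximum. -/
  | slide_cup (s o : Bool) (n : ℕ) :
      LocalMove [(.cup s, n + 1), (.cross o, n)] [(.cup s, n), (.cross (!o), n + 1)]
  | slide_cap (o : Bool) (n : ℕ) :
      LocalMove [(.cross o, n), (.cap, n + 1)] [(.cross (!o), n + 1), (.cap, n)]
  /-- First Reidemeister move, at a minimum and at a maximum. -/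
  | reidemeister1_cup (s o : Bool) (n : ℕ) :
      LocalMove [(.cup s, n), (.cross o, n)] [(.cup (!s), n)]
  | reidemeister1_cap (o : Bool) (n : ℕ) : LocalMove [(.cross o, n), (.cap, n)] [(.cap, n)]
  /-- Second Reidemeister move. -/
  | reidemeister2 (o : Bool) (n : ℕ) : LocalMove [(.cross o, n), (.cross (!o), n)] []
  /-- Third Reidemeister move.  Of the strands `A`, `B`, `C` that enter from left to right, `A` is
  over `B` iff `p`, `A` is over `C` iff `q`, `B` is over `C` iff `r`; the hypothesis says that the
  three strands lie at three different levels. -/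
  | reidemeister3 (p q r : Bool) (n : ℕ) (h : ¬ (p = r ∧ q = !p)) :
      LocalMove [(.cross p, n), (.cross q, n + 1), (.cross r, n)]
        [(.cross r, n + 1), (.cross q, n), (.cross p, n + 1)]

/-- Two diagrams differ by one local move, and are identical elsewhere. -/
def Step (D D' : LinkDiagram) : Prop :=
  ∃ A B U V : List Slice, LocalMove U V ∧ D.word = A ++ U ++ B ∧ D'.word = A ++ V ++ B

/-- Isotopy of oriented links: the equivalence relation generated by the local moves. -/
def isotopy : Setoid LinkDiagram := Relation.EqvGen.setoid Step

/-- `Dp`, `Dm`, `D0` are identical except near one crossing, which is positive in `Dp`, negative in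
`Dm` and smoothed according to the orientation in `D0`.  If the two strands (of directions `x` and
`y` from left to right below the crossing) are both directed up or both directed down, then the
crossing is positive iff the strand from bottom left to top right is the upper one, and the
smoothing consists of two vertical strands.  If one is directed up and one down, then the
crossing is negative in that case, and the smoothing is a maximum below a minimum. -/
def IsSkeinTriple (Dp Dm D0 : LinkDiagram) : Prop :=
  ∃ (A B : List Slice) (l r : List Bool) (x y : Bool),
    run A [] = some (l ++ x :: y :: r) ∧
    Dp.word = A ++ [(.cross (x == y), l.length)] ++ B ∧
    Dm.word = A ++ [(.cross (!(x == y)), l.length)] ++ B ∧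
    D0.word = A ++ (if x = y then [] else [(.cap, l.length), (.cup y, l.length)]) ++ B

/-- `D'` arises from `D` by inserting `2 * k` half twists, in the positive (right-handed) sense,
into two neighbouring parallel strands of opposite directions. Half twists in this sense of two
strands of the same direction would be positive crossings, so these crossings, between
strands of opposite directions, are negative. -/
def IsAntiparallelTwist (k : ℕ) (D D' : LinkDiagram) : Prop :=
  ∃ (A B : List Slice) (l r : List Bool) (x : Bool),
    run A [] = some (l ++ x :: (!x) :: r) ∧
    D.word = A ++ B ∧
    D'.word = A ++ List.replicate (2 * k) (.cross true, l.length) ++ B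

/-- The round circle. -/
def circle : LinkDiagram where
  word := [(.cup true, 0), (.cap, 0)]
  nonempty := by simp
  closed := by simp [run, applySlice]

end LinkDiagram

/-- Isotopy classes of (nonempty) oriented links. -/
def OrientedLink : Type := Quotient LinkDiagram.isotopy

namespace OrientedLink

/-- The oriented link presented by a diagram. -/
def mk (D : LinkDiagram) : OrientedLink := Quotient.mk LinkDiagram.isotopy D

/-- The trivial knot. -/
def unknot : OrientedLink := mk LinkDiagram.circle

/-- `L'` is obtained from `L` by a `t̄_{2k}` move: for suitable diagrams of the two links, `2 * k`
positive half twists are inserted into two antiparallel strands. -/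
def TBarMove (k : ℕ) (L L' : OrientedLink) : Prop :=
  ∃ D D' : LinkDiagram, mk D = L ∧ mk D' = L' ∧ IsAntiparallelTwist k D D'

/-- The ring `ℤ[a, a⁻¹][z, z⁻¹]` of Laurent polynomials in `a` and `z`. -/
abbrev LaurentAZ : Type := LaurentPolynomial (LaurentPolynomial ℤ)

/-- `a ^ n`. -/
noncomputable def aPow (n : ℤ) : LaurentAZ := LaurentPolynomial.C (LaurentPolynomial.T n)

/-- `z`. -/
noncomputable def z : LaurentAZ := LaurentPolynomial.T 1

/-- The properties that describe the Jones-Conway (Homfly) polynomial among the invariants of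
oriented links: it is `1` on the trivial knot, and `a P_{L₊} + a⁻¹ P_{L₋} = z P_{L₀}`. -/
structure IsJonesConway (P : OrientedLink → LaurentAZ) : Prop where
  unknot : P unknot = 1
  skein : ∀ Dp Dm D0 : LinkDiagram, IsSkeinTriple Dp Dm D0 →
    aPow 1 * P (mk Dp) + aPow (-1) * P (mk Dm) = z * P (mk D0)

open Classical in
/-- The Jones-Conway (Homfly) polynomial `P_L(a, z)`: the invariant with the properties
`IsJonesConway`.  (It exists and is unique by the theorem of Freyd, Yetter, Hoste, Lickorish,
Millett, Ocneanu and of Przytycki, Traczyk; a value has to be given by convention in the other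
case, which does not occur, and `0` is used.) -/
noncomputable def homfly : OrientedLink → LaurentAZ :=
  if h : ∃ P, IsJonesConway P then h.choose else 0

/-- Substitution `a = a₀` for a nonzero complex number `a₀`: the image of a Laurent polynomial in
`a` and `z` is a complex Laurent polynomial in `z`. -/
noncomputable def evalA (a₀ : ℂˣ) : LaurentAZ →+* LaurentPolynomial ℂ :=
  AddMonoidAlgebra.mapRingHom ℤ (LaurentPolynomial.eval₂ (Int.castRingHom ℂ) a₀)

end OrientedLink

namespace LinkDiagram

/-! Let `E j` be the diagram with `2 * j` half twists inserted. Apply the skein relation at the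
lowest twist crossing of `E (j + 1)`, which is negative. Switching it allows a second Reidemeister
move, leaving `E j`; smoothing it leaves a maximum below a minimum whose twisted legs unwind by
first Reidemeister moves to a link `M` independent of `j`. Hence `P (E (j + 1)) = -a² P (E j) + a z
P M`, and iterating gives a geometric sum in `-a²` as coefficient of `a z P M`. At `a₀`, `-a₀²` is a
`k`-th root of unity other than `1`, so the sum vanishes and the factor `(-a₀²) ^ k` is `1`. -/

theorem run_append (U V : List Slice) (w : List Bool) :
    run (U ++ V) w = (run U w).bind (run V) := by
  simp only [run, List.foldlM_append]
  rfl

/-- Stacks of slices with the same effect on the row between `A` and `B` are interchangeable. -/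
theorem run_replace {A U V B : List Slice} {w : List Bool} (hA : run A [] = some w)
    (hUV : run U w = run V w) : run (A ++ U ++ B) [] = run (A ++ V ++ B) [] := by
  simp [run_append, hA, hUV]

theorem applySlice_cross (o : Bool) (l r : List Bool) (x y : Bool) :
    applySlice (.cross o, l.length) (l ++ x :: y :: r) = some (l ++ y :: x :: r) := by
  simp [applySlice]

theorem run_cross (o : Bool) (l r : List Bool) (x y : Bool) :
    run [(.cross o, l.length)] (l ++ x :: y :: r) = some (l ++ y :: x :: r) := by
  simp [run, applySlice_cross]

theorem run_cap_cup (l r : List Bool) (x s : Bool) :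
    run [(.cap, l.length), (.cup s, l.length)] (l ++ x :: (!x) :: r) =
      some (l ++ s :: (!s) :: r) := by
  simp [run, applySlice]

/-- An even number of half twists restores the row of strands. -/
theorem run_twists (o : Bool) (l r : List Bool) (x y : Bool) (k : ℕ) :
    run (List.replicate (2 * k) (.cross o, l.length)) (l ++ x :: y :: r) =
      some (l ++ x :: y :: r) := by
  induction k with
  | zero => rfl
  | succ k ih =>
    rw [Nat.mul_succ, List.replicate_add, run_append, ih]
    simp [run, applySlice_cross, List.replicate_succ]

theorem mk_eq_of_localMove {D D' : LinkDiagram} {A B U V : List Slice} (h : LocalMove U V)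
    (hD : D.word = A ++ U ++ B) (hD' : D'.word = A ++ V ++ B) :
    OrientedLink.mk D = OrientedLink.mk D' :=
  Quotient.sound (Relation.EqvGen.rel _ _ ⟨A, B, U, V, h, hD, hD'⟩)

/-- Twists of the two legs of a minimum can be undone by first Reidemeister moves. -/
theorem mk_eq_of_cup_twists (A B : List Slice) (o : Bool) (n m : ℕ) :
    ∀ (s t : Bool) (D D' : LinkDiagram), t = (not^[m] s) →
      D.word = A ++ (.cup s, n) :: List.replicate m (.cross o, n) ++ B →
      D'.word = A ++ [(.cup t, n)] ++ B → OrientedLink.mk D = OrientedLink.mk D' := by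
  induction m with
  | zero =>
    rintro s t D D' rfl hD hD'
    have : D = D' := by
      cases D; cases D'
      simp_all
    rw [this]
  | succ m ih =>
    rintro s t D D' ht hD hD'
    have hD1 : D.word = A ++ [(.cup s, n), (.cross o, n)] ++
        (List.replicate m (.cross o, n) ++ B) := by
      simpa [List.replicate_succ] using hD
    -- This also covers rows shorter than `n`, where both sides are `none`, so the row reached by
    -- `A` need not be known.
    have happ : ∀ w, run [(.cup s, n), (.cross o, n)] w = run [(.cup (!s), n)] w := by
      intro w
      by_cases h : n ≤ w.length
      · have hn : (w.take n).length = n := by simpa using h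
        have hc := applySlice_cross o (w.take n) (w.drop n) s (!s)
        rw [hn] at hc
        simp [run, applySlice, h] at hc ⊢
      · simp [run, applySlice, h]
    have hc : run (A ++ [(.cup (!s), n)] ++ (List.replicate m (.cross o, n) ++ B)) [] =
        some [] := by
      rw [← D.closed, hD1]
      simp only [run_append, Option.bind_assoc]
      congr 1
      funext w
      rw [happ]
    let E : LinkDiagram := ⟨_, by simp, hc⟩
    exact (mk_eq_of_localMove (D' := E) (.reidemeister1_cup s o n) hD1 rfl).trans
      (ih (!s) t E D' (by simpa using ht) (by simp [E]) hD')

end LinkDiagram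

namespace OrientedLink

open LinkDiagram

theorem aPow_add (m n : ℤ) : aPow (m + n) = aPow m * aPow n := by
  rw [aPow, LaurentPolynomial.T_add, map_mul]
  rfl

theorem aPow_neg_mul_aPow (n : ℤ) : aPow (-n) * aPow n = 1 := by
  rw [← aPow_add, neg_add_cancel, aPow, LaurentPolynomial.T_zero, map_one]

/-- The effect of a `t̄_{2k}` move on the Jones-Conway polynomial: `M` is the smoothing of the two
antiparallel strands. -/
theorem jonesConway_antiparallelTwist {P : OrientedLink → LaurentAZ} (hP : IsJonesConway P)
    {k : ℕ} {D D' : LinkDiagram} (h : IsAntiparallelTwist k D D') :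
    ∃ M : OrientedLink, P (mk D') = (-aPow 2) ^ k * P (mk D) +
      (∑ i ∈ Finset.range k, (-aPow 2) ^ i) * (aPow 1 * z * P M) := by
  obtain ⟨A, B, l, r, x, hA, hD, hD'⟩ := h
  have hB : run B (l ++ x :: (!x) :: r) = some [] := by
    have := D.closed
    simpa [hD, run_append, hA] using this
  let c : Slice := (.cross true, l.length)
  let E : ℕ → LinkDiagram := fun j =>
    { word := A ++ List.replicate (2 * j) c ++ B
      nonempty := fun h0 => D.nonempty (by simp_all)
      closed := by simp [run_append, hA, c, run_twists, hB] }
  let S : LinkDiagram :=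
    { word := A ++ [(.cap, l.length), (.cup x, l.length)] ++ B
      nonempty := by simp
      closed := by
        simp only [run_append, hA, Option.bind_some, run_cap_cup, hB] }
  have hE0 : E 0 = D := by
    cases D
    simp only [E, LinkDiagram.mk.injEq]
    simpa using hD.symm
  have hEk : E k = D' := by
    cases D'
    simp_all [E, c]
  have step (j : ℕ) : P (mk (E (j + 1))) = -aPow 2 * P (mk (E j)) + aPow 1 * z * P (mk S) := by
    -- `C` is what lies above the lowest twist crossing of `E (j + 1)`; it starts from the swapped
    -- row.
    let C : List Slice := List.replicate (2 * j + 1) c ++ B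
    have hC : run C (l ++ (!x) :: x :: r) = some [] := by
      have h1 : run [c] (l ++ (!x) :: x :: r) = some (l ++ x :: (!x) :: r) := run_cross _ _ _ _ _
      have h2 : C = [c] ++ (List.replicate (2 * j) c ++ B) := by simp [C, List.replicate_succ]
      rw [h2, run_append, h1]
      simp [run_append, c, run_twists, hB]
    let Dp : LinkDiagram :=
      { word := A ++ [(.cross false, l.length)] ++ C
        nonempty := by simp
        closed := by
          simp only [run_append, hA, Option.bind_some, run_cross, hC] }
    let D0 : LinkDiagram :=
      { word := A ++ [(.cap, l.length), (.cup (!x), l.length)] ++ C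
        nonempty := by simp
        closed := by
          have := run_cap_cup l r x (!x)
          rw [Bool.not_not] at this
          simp only [run_append, hA, Option.bind_some, this, hC] }
    have hsk : IsSkeinTriple Dp (E (j + 1)) D0 := by
      refine ⟨A, C, l, r, x, !x, hA, ?_, ?_, ?_⟩
      · simp [Dp]
      · simp [E, C, c, Nat.mul_succ, List.replicate_succ]
      · simp [D0]
    have hp : mk Dp = mk (E j) := by
      refine mk_eq_of_localMove (A := A) (B := List.replicate (2 * j) c ++ B)
        (.reidemeister2 false l.length) ?_ ?_
      · simp [Dp, C, c, List.replicate_succ]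
      · simp [E]
    -- Each first Reidemeister move reverses the minimum, and `2 * j + 1` is odd, so its direction
    -- ends as `x` for every `j`.
    have h0 : mk D0 = mk S := by
      refine mk_eq_of_cup_twists (A ++ [(.cap, l.length)]) B true l.length (2 * j + 1) (!x) x _ _
        ?_ ?_ ?_
      · rw [Bool.involutive_not.iterate_odd ⟨j, rfl⟩, Bool.not_not]
      · simp [D0, C, c]
      · simp [S]
    have hs := hP.skein _ _ _ hsk
    rw [hp, h0] at hs
    have h1 := aPow_neg_mul_aPow 1
    have h2 : aPow 2 = aPow 1 * aPow 1 := aPow_add 1 1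
    rw [h2]
    linear_combination aPow 1 * hs - P (mk (E (j + 1))) * h1
  refine ⟨mk S, ?_⟩
  rw [← hE0, ← hEk]
  clear hD' hEk
  induction k with
  | zero => simp
  | succ k ih =>
    -- Splitting off the term `i = 0` leaves a sum divisible by `-a²`, matching the recursion.
    rw [step, ih, Finset.sum_range_succ', pow_succ]
    simp only [pow_succ, ← Finset.sum_mul]
    ring

theorem evalA_aPow (a₀ : ℂˣ) (n : ℤ) :
    evalA a₀ (aPow n) = LaurentPolynomial.C ((a₀ ^ n : ℂˣ) : ℂ) := by
  have h : aPow n = AddMonoidAlgebra.single 0 (LaurentPolynomial.T n) := rfl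
  rw [h, evalA, AddMonoidAlgebra.mapRingHom_single, LaurentPolynomial.eval₂_T]
  rfl

/-- If `-a₀ ^ 2` is a `k`-th root of unity other than `1`, then a `t̄_{2k}` move preserves every
Jones-Conway invariant at `a = a₀`. -/
theorem evalA_jonesConway_eq_of_tBarMove {P : OrientedLink → LaurentAZ} (hP : IsJonesConway P)
    {k : ℕ} {a₀ : ℂˣ} (hk : (-(a₀ : ℂ) ^ 2) ^ k = 1) (h1 : -(a₀ : ℂ) ^ 2 ≠ 1)
    {L L' : OrientedLink} (h : TBarMove k L L') : evalA a₀ (P L') = evalA a₀ (P L) := by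
  obtain ⟨D, D', rfl, rfl, hDD'⟩ := h
  obtain ⟨M, hM⟩ := jonesConway_antiparallelTwist hP hDD'
  have ha : evalA a₀ (-aPow 2) = LaurentPolynomial.C (-(a₀ : ℂ) ^ 2) := by
    rw [map_neg, evalA_aPow, map_neg]
    norm_cast
  have hsum : ∑ i ∈ Finset.range k, (-(a₀ : ℂ) ^ 2) ^ i = 0 := by
    rw [geom_sum_eq h1, hk, sub_self, zero_div]
  rw [hM, map_add, map_mul, map_mul, map_sum]
  simp only [map_pow, ha]
  simp only [← map_pow, ← map_sum, hk, hsum]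
  simp

theorem homfly_isJonesConway (h : ∃ P, IsJonesConway P) : IsJonesConway homfly := by
  rw [homfly, dif_pos h]
  exact h.choose_spec

end OrientedLink

theorem corollary1p8 (k : ℕ) (a₀ : ℂˣ) (hk : (a₀ : ℂ) ^ (2 * k) = (-1) ^ k)
    (hi : (a₀ : ℂ) ≠ Complex.I) (hi' : (a₀ : ℂ) ≠ -Complex.I)
    (L L' : OrientedLink) (hLL' : OrientedLink.TBarMove k L L') :
    OrientedLink.evalA a₀ (OrientedLink.homfly L') =
      OrientedLink.evalA a₀ (OrientedLink.homfly L) := by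
  by_cases h : ∃ P, OrientedLink.IsJonesConway P
  · refine OrientedLink.evalA_jonesConway_eq_of_tBarMove (OrientedLink.homfly_isJonesConway h) ?_ ?_ hLL'
    · rw [neg_pow, ← pow_mul, hk, ← mul_pow]
      simp
    · intro h1
      -- `-a₀² = 1` says that `a₀` is a root of `X² + 1`.
      have : ((a₀ : ℂ) - Complex.I) * (a₀ + Complex.I) = 0 := by
        linear_combination -h1 - Complex.I_sq
      rcases mul_eq_zero.1 this with h0 | h0
      · exact hi (sub_eq_zero.1 h0)
      · exact hi' (eq_neg_of_add_eq_zero_left h0)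
  -- Here `homfly` is the conventional `0`, so the existence theorem is not needed.
  · simp [OrientedLink.homfly, h]
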